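/- Let $N\ge 1$ be an integer and let $N=p_1p_2\cdots p_m$ be its factorization into primes (with repetitions, in any order), so that, after labelling the product basis by $1,\dots,N$ (in any way), $\mathbb C^N=\mathbb C^{p_1}\otimes\cdots\otimes\mathbb C^{p_m}$. For a prime $P$, let the generators of $su(P)$ be the matrices $\lambda_{ij}=|i\rangle\langle j|+|j\rangle\langle i|$ and $\hat\lambda_{ij}=-i|i\rangle\langle j|+i|j\rangle\langle i|$ for $1\le i<j\le P$, together with the members of a chosen basis of the real vector space of real diagonal traceless $P\times P$ matrices (any basis, chosen for each tensor factor; for $P=2$ and the diagonal generator $\mathrm{diag}(1,-1)$ these are the Pauli matrices). Consider tensor products $g=A_1\otimes\cdots\otimes A_m$ in which every $A_k$ is either one of these generators of $su(p_k)$ or the identity, and not all $A_k$ are identities. For $\omega\in\mathbb R$, the gate $e^{i\omega g}$ is called local if exactly one factor $A_k$ of $g$ is not the identity, and nonlocal if at least two are not. **Theorem of Gate Decomposition.** Every unitary transformation $U\in SU(N)$ can be fully decomposed into a finite product of local and nonlocal gates, $$U=e^{i\omega_1g_1}\,e^{i\omega_2g_2}\cdots e^{i\omega_ng_n}.$$ Here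 the finite sequence $g_1,\dots,g_n$ depends only on $N$ and the chosen representation (the factorization, labelling and diagonal bases), and only the real parameters $\omega_1,\dots,\omega_n$ depend on $U$. -/

import Mathlib

namespace GateDecomposition

/-- `D` is a complete system of diagonal generators of `su(P)`: a basis of the space of real
diagonal traceless matrices, a diagonal matrix being recorded by its vector of diagonal entries.
Examples: `{(1, -1)}` for `P = 2` (the Pauli matrix `σ₃`); any `P - 1` independent matrices
among the `d_kl = |k⟩⟨k| - |l⟩⟨l|`; the diagonal Gell-Mann matrices `μ₃, μ₈` for `P = 3`. -/
def IsDiagonalSystem {P : ℕ} (D : Set (Fin P → ℝ)) : Prop :=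
  LinearIndepOn ℝ id D ∧ ∀ d : Fin P → ℝ, d ∈ Submodule.span ℝ D ↔ ∑ a, d a = 0

/-- The generators of `su(P)` in the `λ`-representation, with diagonal generators taken from `D`.
For `P = 2` and `D = {(1, -1)}` they are the three Pauli matrices. -/
inductive IsGenerator {P : ℕ} (D : Set (Fin P → ℝ)) : Matrix (Fin P) (Fin P) ℂ → Prop
  /-- `λ_ij = |i⟩⟨j| + |j⟩⟨i|` -/
  | lam (i j : Fin P) (hij : i < j) :
      IsGenerator D (Matrix.single i j 1 + Matrix.single j i 1)
  /-- `λ̂_ij = -i|i⟩⟨j| + i|j⟩⟨i|` -/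
  | lamHat (i j : Fin P) (hij : i < j) :
      IsGenerator D (Matrix.single i j (-Complex.I) + Matrix.single j i Complex.I)
  /-- a chosen diagonal generator -/
  | diag (d : Fin P → ℝ) (hd : d ∈ D) :
      IsGenerator D (Matrix.diagonal fun a => (d a : ℂ))

/-- The tensor (Kronecker) product `A 0 ⊗ A 1 ⊗ ⋯ ⊗ A (m-1)`, written as an `N × N` matrix through
a labelling `e` of the product basis by `0, …, N - 1`. -/
def tensor {m N : ℕ} {p : Fin m → ℕ} (e : (∀ k, Fin (p k)) ≃ Fin N)
    (A : ∀ k, Matrix (Fin (p k)) (Fin (p k)) ℂ) : Matrix (Fin N) (Fin N) ℂ :=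
  Matrix.of fun x y => ∏ k, A k (e.symm x k) (e.symm y k)

/-- `g` is a tensor product whose factors are generators at the positions in `S` and identity
matrices at the other positions. -/
def IsTensorOn {m N : ℕ} {p : Fin m → ℕ} (e : (∀ k, Fin (p k)) ≃ Fin N)
    (D : ∀ k, Set (Fin (p k) → ℝ)) (S : Finset (Fin m)) (g : Matrix (Fin N) (Fin N) ℂ) : Prop :=
  ∃ A : ∀ k, Matrix (Fin (p k)) (Fin (p k)) ℂ,
    (∀ k ∈ S, IsGenerator (D k) (A k)) ∧ (∀ k ∉ S, A k = 1) ∧ g = tensor e A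

/-- Local: exactly one factor is not the identity. -/
def IsLocalGenerator {m N : ℕ} {p : Fin m → ℕ} (e : (∀ k, Fin (p k)) ≃ Fin N)
    (D : ∀ k, Set (Fin (p k) → ℝ)) (g : Matrix (Fin N) (Fin N) ℂ) : Prop :=
  ∃ S : Finset (Fin m), S.card = 1 ∧ IsTensorOn e D S g

/-- Nonlocal: at least two factors are not the identity. (The product of identities only is not
in `su(N)` and is neither local nor nonlocal.) -/
def IsNonlocalGenerator {m N : ℕ} {p : Fin m → ℕ} (e : (∀ k, Fin (p k)) ≃ Fin N)
    (D : ∀ k, Set (Fin (p k) → ℝ)) (g : Matrix (Fin N) (Fin N) ℂ) : Prop :=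
  ∃ S : Finset (Fin m), 2 ≤ S.card ∧ IsTensorOn e D S g

/-- The gate `exp(i ω g)`. -/
noncomputable def gate {N : ℕ} (ω : ℝ) (g : Matrix (Fin N) (Fin N) ℂ) :
    Matrix (Fin N) (Fin N) ℂ :=
  NormedSpace.exp ((Complex.I * (ω : ℂ)) • g)

end GateDecomposition

/-! The proof is local surjectivity plus a bounded number of repetitions. Over ℂ, the generators of
`su(P)` and the identity span all matrices, hence their tensor products do too; as all of these are
Hermitian, their real span is the space of Hermitian matrices
(`mem_span_insert_one_gateGenerators`).

The derivative at 0 of the ordered gate product is `ω ↦ ∑ ω_α i g_α`, so with the identity included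
it maps onto the skew-Hermitian matrices. Multiplying by `1 + (B + Bᴴ)` supplies the Hermitian
directions, so surjectivity of the derivative applies in the full matrix space, with no manifold
structure on the unitary group. Unitarity makes the extra factor trivial, and the determinant
removes the identity generator (`eventually_exists_gateProduct_eq_of_specialUnitary`).

Finally, each special unitary is `exp(iK₁) exp(iK₂)` with traceless Hermitian `K₁`, `K₂` of norm
bounded uniformly in `U`. Taking `k`-th roots `exp(iK/k)`, with `k` independent of `U`, lands in the
good neighbourhood of 1; the generators repeated `2k` times then suffice. -/

namespace GateDecomposition

open Matrix
open scoped Matrix.Norms.L2Operator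

/-! ### Exponentials and logarithms of unitary matrices. -/

section Exponential

variable {n : Type*} [Fintype n] [DecidableEq n]

/-- Jacobi's formula for the exponential of `i H`, with `H` Hermitian. -/
theorem det_exp_I_smul {H : Matrix n n ℂ} (hH : H.IsHermitian) :
    (NormedSpace.exp (Complex.I • H)).det = Complex.exp (Complex.I * H.trace) := by
  set V : Matrix n n ℂ := (hH.eigenvectorUnitary : Matrix n n ℂ)
  have hVV : V * star V = 1 := Unitary.mul_star_self_of_mem hH.eigenvectorUnitary.2
  have hunit : IsUnit V := IsUnit.of_mul_eq_one _ hVV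
  have hinv : V⁻¹ = star V := inv_eq_right_inv hVV
  have hspec : H = V * diagonal (fun i => (hH.eigenvalues i : ℂ)) * V⁻¹ := by
    rw [hinv]
    exact hH.spectral_theorem
  have h1 : Complex.I • H =
      V * diagonal (fun i => Complex.I * (hH.eigenvalues i : ℂ)) * V⁻¹ := by
    have : diagonal (fun i => Complex.I * (hH.eigenvalues i : ℂ)) =
        Complex.I • diagonal (fun i => (hH.eigenvalues i : ℂ)) := by
      rw [← diagonal_smul]; rfl
    rw [this, mul_smul_comm, smul_mul_assoc, ← hspec]
  rw [h1, Matrix.exp_conj _ _ hunit, det_conj hunit, Matrix.exp_diagonal, det_diagonal,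
    hH.trace_eq_sum_eigenvalues, Finset.mul_sum, Complex.exp_sum]
  refine Finset.prod_congr rfl fun i _ => ?_
  rw [Pi.coe_exp, Complex.exp_eq_exp_ℂ]
  congr!

theorem exp_I_smul_mem_unitary {H : Matrix n n ℂ} (hH : H.IsHermitian) :
    NormedSpace.exp (Complex.I • H) ∈ unitary (Matrix n n ℂ) :=
  (selfAdjoint.expUnitary (⟨H, hH⟩ : selfAdjoint (Matrix n n ℂ))).2

/-- Every unitary matrix is `exp (i H)` for some Hermitian `H` of norm at most `π`. -/
theorem exists_exp_I_smul_eq {U : Matrix n n ℂ} (hU : U ∈ unitary (Matrix n n ℂ)) :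
    ∃ H : Matrix n n ℂ, H.IsHermitian ∧ ‖H‖ ≤ Real.pi ∧ NormedSpace.exp (Complex.I • H) = U := by
  have hn : IsStarNormal U := Unitary.coe_isStarNormal ⟨U, hU⟩
  -- The spectrum is finite, so the jump of `arg` on the negative axis does no harm.
  have hc (f : ℂ → ℂ) : ContinuousOn f (spectrum ℂ U) := U.finite_spectrum.continuousOn f
  refine ⟨cfc (fun z : ℂ => (z.arg : ℂ)) U, IsSelfAdjoint.cfc_arg U,
    norm_cfc_le Real.pi_nonneg fun y _ => by simpa using Complex.abs_arg_le_pi y, ?_⟩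
  rw [← CFC.exp_eq_normedSpace_exp (𝕜 := ℂ), ← cfc_comp_smul .., 
    ← cfc_comp' (fun z : ℂ => NormedSpace.exp (Complex.I • z)) (fun z => (z.arg : ℂ)) U
      (NormedSpace.exp_continuous.comp (continuous_const_smul Complex.I)).continuousOn (hc _)]
  conv_rhs => rw [← cfc_id' ℂ U]
  refine cfc_congr fun y hy => ?_
  have hy₁ : ‖y‖ = 1 := spectrum.norm_eq_one_of_unitary hU hy
  have : Complex.I * y.arg = Complex.log y :=
    Complex.ext (by simp [Complex.log_re, hy₁]) (by simp [Complex.log_im])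
  have hy0 : y ≠ 0 := by rintro rfl; simp at hy₁
  simpa [← Complex.exp_eq_exp_ℂ, this] using Complex.exp_log hy0

end Exponential

end GateDecomposition

namespace GateDecomposition

open Matrix
open scoped Matrix.Norms.L2Operator

/-! ### Spans of generators and of their tensor products. -/

section Span

/-- If `S k` spans for each `k`, the values of a multilinear map at tuples from the `S k` span
its range. -/
theorem multilinearMap_mem_span {R ι M : Type*} {V : ι → Type*} [DecidableEq ι] [Fintype ι]
    [CommSemiring R] [∀ k, AddCommMonoid (V k)] [∀ k, Module R (V k)] [AddCommMonoid M] [Module R M]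
    (f : MultilinearMap R V M) (S : ∀ k, Set (V k)) (hS : ∀ k, Submodule.span R (S k) = ⊤)
    (v : ∀ k, V k) : f v ∈ Submodule.span R (f '' Set.univ.pi S) := by
  -- Induction on the set `s` of slots whose entries are still unrestricted.
  suffices h : ∀ s : Finset ι, ∀ v : ∀ k, V k, (∀ k ∉ s, v k ∈ S k) →
      f v ∈ Submodule.span R (f '' Set.univ.pi S) from h Finset.univ v (by simp)
  intro s
  induction s using Finset.induction_on with
  | empty =>
    intro v hv
    exact Submodule.subset_span ⟨v, fun k _ => hv k (by simp), rfl⟩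
  | insert a s _ ih =>
    intro v hv
    have key : ∀ x ∈ Submodule.span R (S a), f (Function.update v a x) ∈
        Submodule.span R (f '' Set.univ.pi S) := by
      intro x hx
      induction hx using Submodule.span_induction with
      | mem x hx =>
        refine ih _ fun k hk => ?_
        by_cases hka : k = a
        · subst hka; simpa using hx
        · rw [Function.update_of_ne hka]
          exact hv k (by simp [hka, hk])
      | zero => rw [f.map_update_zero]; exact zero_mem _
      | add x y _ _ hx hy => rw [f.map_update_add]; exact add_mem hx hy
      | smul c x _ hx => rw [f.map_update_smul]; exact Submodule.smul_mem _ _ hx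
    simpa using key (v a) (hS a ▸ Submodule.mem_top)

variable {P : ℕ}

theorem IsGenerator.isHermitian {D : Set (Fin P → ℝ)} {A : Matrix (Fin P) (Fin P) ℂ}
    (h : IsGenerator D A) : A.IsHermitian := by
  cases h with
  | lam i j hij => simp [Matrix.IsHermitian, conjTranspose_single, add_comm]
  | lamHat i j hij => simp [Matrix.IsHermitian, conjTranspose_single, add_comm]
  | diag d hd =>
    rw [Matrix.IsHermitian, diagonal_conjTranspose]
    congr 1
    ext a
    simp

theorem IsGenerator.trace_eq_zero {D : Set (Fin P → ℝ)} (hD : IsDiagonalSystem D)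
    {A : Matrix (Fin P) (Fin P) ℂ} (h : IsGenerator D A) : A.trace = 0 := by
  cases h with
  | lam i j hij =>
    simp [trace_add, trace_single_eq_of_ne _ _ _ hij.ne, trace_single_eq_of_ne _ _ _ hij.ne']
  | lamHat i j hij =>
    simp [trace_add, trace_single_eq_of_ne _ _ _ hij.ne, trace_single_eq_of_ne _ _ _ hij.ne']
  | diag d hd =>
    rw [trace_diagonal]
    exact_mod_cast (hD.2 d).1 (Submodule.subset_span hd)

/-- The generators of `su(P)` and the identity span all complex matrices. -/
theorem span_insert_one_isGenerator (hP : P ≠ 0) {D : Set (Fin P → ℝ)} (hD : IsDiagonalSystem D) :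
    Submodule.span ℂ (insert 1 {A | IsGenerator D A}) = ⊤ := by
  set W := Submodule.span ℂ (insert 1 {A : Matrix (Fin P) (Fin P) ℂ | IsGenerator D A})
  have hgen {A} (h : IsGenerator D A) : A ∈ W := Submodule.subset_span (Or.inr h)
  have hone : (1 : Matrix (Fin P) (Fin P) ℂ) ∈ W := Submodule.subset_span (Or.inl rfl)
  have htraceless : ∀ d ∈ Submodule.span ℝ D, diagonal (fun a => (d a : ℂ)) ∈ W := by
    intro d hd
    induction hd using Submodule.span_induction with
    | mem d hd => exact hgen (.diag d hd)
    | zero => simp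
    | add x y _ _ hx hy =>
      have := add_mem hx hy
      rw [diagonal_add] at this
      simpa using this
    | smul c x _ hx =>
      have := W.smul_mem (c : ℂ) hx
      rw [← diagonal_smul] at this
      convert this using 2
      ext a; simp
  have hP' : (P : ℂ) ≠ 0 := by exact_mod_cast hP
  have hdiag (i : Fin P) : single i i (1 : ℂ) ∈ W := by
    -- `P |i⟩⟨i| - 1` is traceless; adding the identity and dividing by `P` isolates `|i⟩⟨i|`.
    have h1 := htraceless (fun a => (if a = i then (P : ℝ) else 0) - 1) ((hD.2 _).2 (by simp))
    have h2 := W.smul_mem (P : ℂ)⁻¹ (add_mem h1 hone)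
    convert h2 using 1
    ext a b
    by_cases hab : a = b
    · subst hab
      by_cases hai : a = i
      · subst hai; simp [hP']
      · simp [hai, Ne.symm hai]
    · by_cases hai : i = a
      · subst hai; simp [hab]
      · simp [hab, hai]
  have hlt (i j : Fin P) (hij : i < j) : single i j (1 : ℂ) ∈ W ∧ single j i (1 : ℂ) ∈ W := by
    have h1 := hgen (.lam (D := D) i j hij)
    have h2 := W.smul_mem Complex.I (hgen (.lamHat (D := D) i j hij))
    have e : Complex.I • (single i j (-Complex.I) + single j i Complex.I) =
        single i j (1 : ℂ) - single j i 1 := by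
      ext a b
      simp only [Matrix.smul_apply, Matrix.add_apply, Matrix.sub_apply, single_apply]
      split_ifs <;> simp
    rw [e] at h2
    constructor
    · have := W.smul_mem (2 : ℂ)⁻¹ (add_mem h1 h2)
      convert this using 1
      simp only [smul_add, smul_sub, smul_single]
      rw [add_add_sub_cancel, ← single_add]; norm_num
    · have := W.smul_mem (2 : ℂ)⁻¹ (sub_mem h1 h2)
      convert this using 1
      simp only [smul_add, smul_sub, smul_single]
      rw [add_sub_sub_cancel, ← single_add]; norm_num
  rw [eq_top_iff]
  intro A _
  rw [matrix_eq_sum_single A]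
  refine sum_mem fun i _ => sum_mem fun j _ => ?_
  have : single i j (A i j) = A i j • single i j (1 : ℂ) := by simp [smul_single]
  rw [this]
  refine W.smul_mem _ ?_
  rcases lt_trichotomy i j with h | rfl | h
  · exact (hlt i j h).1
  · exact hdiag i
  · exact (hlt j i h).2

variable {m N : ℕ} {p : Fin m → ℕ} (e : (∀ k, Fin (p k)) ≃ Fin N)

theorem tensor_update_apply [DecidableEq (Fin m)] (A : ∀ k, Matrix (Fin (p k)) (Fin (p k)) ℂ)
    (k : Fin m) (x : Matrix (Fin (p k)) (Fin (p k)) ℂ) (a b : Fin N) :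
    tensor e (Function.update A k x) a b = x (e.symm a k) (e.symm b k) *
      ∏ l ∈ Finset.univ.erase k, A l (e.symm a l) (e.symm b l) := by
  rw [tensor, of_apply, ← Finset.mul_prod_erase _ _ (Finset.mem_univ k), Function.update_self]
  congr 1
  refine Finset.prod_congr rfl fun l hl => ?_
  rw [Function.update_of_ne (Finset.ne_of_mem_erase hl)]

/-- The tensor product as a multilinear map. -/
def tensorMultilinear :
    MultilinearMap ℂ (fun k => Matrix (Fin (p k)) (Fin (p k)) ℂ) (Matrix (Fin N) (Fin N) ℂ) where
  toFun := tensor e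
  map_update_add' A k x y := by
    ext a b
    simp only [tensor_update_apply, Matrix.add_apply, add_mul]
  map_update_smul' A k c x := by
    ext a b
    simp only [tensor_update_apply, Matrix.smul_apply, smul_eq_mul, mul_assoc]

theorem tensor_single (i j : ∀ k, Fin (p k)) :
    tensor e (fun k => single (i k) (j k) 1) = single (e i) (e j) 1 := by
  ext a b
  simp only [tensor, of_apply, single_apply, Finset.prod_ite_zero, Finset.prod_const_one]
  congr 1
  simp only [Finset.mem_univ, forall_const, forall_and, ← funext_iff,
    ← Equiv.eq_symm_apply]

theorem tensor_one : tensor e (fun _ => 1) = 1 := by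
  ext a b
  simp only [tensor, of_apply, one_apply, Finset.prod_ite_zero, Finset.prod_const_one]
  congr 1
  simp [← funext_iff]

theorem trace_tensor (A : ∀ k, Matrix (Fin (p k)) (Fin (p k)) ℂ) :
    (tensor e A).trace = ∏ k, (A k).trace := by
  simp only [trace, diag_apply, tensor, of_apply]
  rw [← e.sum_comp]
  simp only [Equiv.symm_apply_apply]
  rw [Finset.prod_univ_sum, Fintype.piFinset_univ]

theorem isHermitian_tensor {A : ∀ k, Matrix (Fin (p k)) (Fin (p k)) ℂ}
    (hA : ∀ k, (A k).IsHermitian) : (tensor e A).IsHermitian := by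
  ext a b
  simp only [tensor, of_apply, conjTranspose_apply, star_prod]
  exact Finset.prod_congr rfl fun k _ => (hA k).apply _ _

/-- The generators, local and nonlocal, of the gates. -/
def gateGenerators (D : ∀ k, Set (Fin (p k) → ℝ)) : Set (Matrix (Fin N) (Fin N) ℂ) :=
  {g | IsLocalGenerator e D g ∨ IsNonlocalGenerator e D g}

variable {e} {D : ∀ k, Set (Fin (p k) → ℝ)}

theorem mem_gateGenerators_iff {g : Matrix (Fin N) (Fin N) ℂ} :
    g ∈ gateGenerators e D ↔ ∃ S : Finset (Fin m), S.Nonempty ∧ IsTensorOn e D S g := by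
  constructor
  · rintro (⟨S, hS, h⟩ | ⟨S, hS, h⟩) <;> exact ⟨S, Finset.card_pos.1 (by omega), h⟩
  · rintro ⟨S, hS, h⟩
    have := Finset.card_pos.2 hS
    rcases (show S.card = 1 ∨ 2 ≤ S.card by omega) with h1 | h1
    · exact Or.inl ⟨S, h1, h⟩
    · exact Or.inr ⟨S, h1, h⟩

theorem isHermitian_of_mem_gateGenerators {g : Matrix (Fin N) (Fin N) ℂ}
    (hg : g ∈ gateGenerators e D) : g.IsHermitian := by
  obtain ⟨S, -, A, hA, hA', rfl⟩ := mem_gateGenerators_iff.1 hg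
  refine isHermitian_tensor e fun k => ?_
  by_cases hk : k ∈ S
  · exact (hA k hk).isHermitian
  · rw [hA' k hk]; exact isHermitian_one

theorem trace_of_mem_gateGenerators (hD : ∀ k, IsDiagonalSystem (D k))
    {g : Matrix (Fin N) (Fin N) ℂ} (hg : g ∈ gateGenerators e D) : g.trace = 0 := by
  obtain ⟨S, ⟨k, hk⟩, A, hA, -, rfl⟩ := mem_gateGenerators_iff.1 hg
  rw [trace_tensor]
  exact Finset.prod_eq_zero (Finset.mem_univ k) ((hA k hk).trace_eq_zero (hD k))

theorem span_insert_one_gateGenerators (hp : ∀ k, p k ≠ 0) (hD : ∀ k, IsDiagonalSystem (D k)) :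
    Submodule.span ℂ (insert 1 (gateGenerators e D)) = ⊤ := by
  classical
  have hsub : tensorMultilinear e '' Set.univ.pi (fun k => insert 1 {A | IsGenerator (D k) A}) ⊆
      insert 1 (gateGenerators e D) := by
    rintro _ ⟨A, hA, rfl⟩
    set S : Finset (Fin m) := Finset.univ.filter fun k => A k ≠ 1 with hS
    have hgen : ∀ k ∈ S, IsGenerator (D k) (A k) := fun k hk =>
      (hA k trivial).resolve_left (by simpa [hS] using hk)
    have hone : ∀ k ∉ S, A k = 1 := fun k hk => by simpa [hS] using hk
    rcases S.eq_empty_or_nonempty with h | h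
    · left
      have : A = fun _ => 1 := funext fun k => hone k (by simp [h])
      rw [this]
      exact tensor_one e
    · exact Or.inr (mem_gateGenerators_iff.2 ⟨S, h, A, hgen, hone, rfl⟩)
  rw [eq_top_iff]
  intro B _
  refine Submodule.span_mono hsub ?_
  rw [matrix_eq_sum_single B]
  refine sum_mem fun i _ => sum_mem fun j _ => ?_
  have : single i j (B i j) =
      B i j • tensorMultilinear e (fun k => single (e.symm i k) (e.symm j k) 1) := by
    change _ = B i j • tensor e _
    rw [tensor_single]
    simp [smul_single]
  rw [this]
  exact Submodule.smul_mem _ _ (multilinearMap_mem_span _ _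
    (fun k => span_insert_one_isGenerator (hp k) (hD k)) _)

/-- The real span of a set of Hermitian matrices contains the Hermitian part of every matrix in its
complex span. -/
theorem mem_span_real_of_mem_span_complex {n : Type*} {S : Set (Matrix n n ℂ)}
    (hS : ∀ g ∈ S, g.IsHermitian) {K : Matrix n n ℂ} (hK : K.IsHermitian)
    (h : K ∈ Submodule.span ℂ S) : K ∈ Submodule.span ℝ S := by
  -- Quantifying over the scalar `c` lets the span induction pass through complex multiples.
  have key : ∀ B ∈ Submodule.span ℂ S, ∀ c : ℂ, c • B + (c • B)ᴴ ∈ Submodule.span ℝ S := by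
    intro B hB
    induction hB using Submodule.span_induction with
    | mem g hg =>
      intro c
      have : c • g + (c • g)ᴴ = (2 * c.re) • g := by
        rw [conjTranspose_smul, (hS g hg).eq, ← add_smul]
        ext i j
        simp only [Matrix.smul_apply, smul_eq_mul, Complex.real_smul]
        rw [Complex.star_def, Complex.add_conj]
      rw [this]
      exact Submodule.smul_mem _ _ (Submodule.subset_span hg)
    | zero => intro c; simp
    | add x y _ _ hx hy =>
      intro c
      have := add_mem (hx c) (hy c)
      rw [smul_add, conjTranspose_add, add_add_add_comm]
      exact this
    | smul a x _ hx => intro c; simpa [smul_smul] using hx (c * a)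
  have h2 := Submodule.smul_mem _ (2⁻¹ : ℝ) (key K h 1)
  rw [one_smul, hK.eq, ← two_smul ℝ, smul_smul] at h2
  simpa using h2

/-- The generators of the gates, together with the identity, span the Hermitian matrices. -/
theorem mem_span_insert_one_gateGenerators (hp : ∀ k, p k ≠ 0) (hD : ∀ k, IsDiagonalSystem (D k))
    {K : Matrix (Fin N) (Fin N) ℂ} (hK : K.IsHermitian) :
    K ∈ Submodule.span ℝ (insert 1 (gateGenerators e D)) := by
  refine mem_span_real_of_mem_span_complex ?_ hK
    (by rw [span_insert_one_gateGenerators hp hD]; trivial)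
  rintro g (rfl | hg)
  · exact isHermitian_one
  · exact isHermitian_of_mem_gateGenerators hg

end Span

end GateDecomposition

namespace GateDecomposition

open Matrix Topology Filter
open scoped Matrix.Norms.L2Operator

/-! ### Gate products fill a neighbourhood of 1 in `SU(N)`. -/

section GateProducts

theorem IsHermitian.real_smul {n : Type*} {H : Matrix n n ℂ} (hH : H.IsHermitian) (t : ℝ) :
    (t • H).IsHermitian := by
  rw [Matrix.IsHermitian, conjTranspose_smul, hH.eq, star_trivial]

variable {N : ℕ}

theorem gate_eq_exp_real_smul (t : ℝ) (g : Matrix (Fin N) (Fin N) ℂ) :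
    gate t g = NormedSpace.exp (t • (Complex.I • g)) := by
  rw [gate, mul_comm, mul_smul]
  rfl

theorem gate_eq_exp_I_smul (t : ℝ) (g : Matrix (Fin N) (Fin N) ℂ) :
    gate t g = NormedSpace.exp (Complex.I • (t • g)) := by
  rw [gate, mul_smul]
  rfl

theorem gate_zero (g : Matrix (Fin N) (Fin N) ℂ) : gate 0 g = 1 := by
  simp [gate]

theorem gate_mem_unitary {g : Matrix (Fin N) (Fin N) ℂ} (hg : g.IsHermitian) (t : ℝ) :
    gate t g ∈ unitary (Matrix (Fin N) (Fin N) ℂ) := by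
  rw [gate_eq_exp_I_smul]
  exact exp_I_smul_mem_unitary (IsHermitian.real_smul hg t)

theorem det_gate {g : Matrix (Fin N) (Fin N) ℂ} (hg : g.IsHermitian) (t : ℝ) :
    (gate t g).det = Complex.exp (Complex.I * (t * g.trace)) := by
  rw [gate_eq_exp_I_smul, det_exp_I_smul (IsHermitian.real_smul hg t), trace_smul,
    Complex.real_smul]

/-- The ordered product of the gates `exp (i ω_α g_α)`. -/
noncomputable def gateProduct {d : ℕ} (g : Fin d → Matrix (Fin N) (Fin N) ℂ) (ω : Fin d → ℝ) :
    Matrix (Fin N) (Fin N) ℂ :=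
  (List.ofFn fun α => gate (ω α) (g α)).prod

theorem gateProduct_zero {d : ℕ} (g : Fin d → Matrix (Fin N) (Fin N) ℂ) : gateProduct g 0 = 1 :=
  List.prod_eq_one fun x hx => by
    obtain ⟨α, rfl⟩ := (List.mem_ofFn' _ _).1 hx
    exact gate_zero _

theorem gateProduct_mem_unitary {d : ℕ} {g : Fin d → Matrix (Fin N) (Fin N) ℂ}
    (hg : ∀ α, (g α).IsHermitian) (ω : Fin d → ℝ) :
    gateProduct g ω ∈ unitary (Matrix (Fin N) (Fin N) ℂ) :=
  list_prod_mem fun x hx => by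
    obtain ⟨α, rfl⟩ := (List.mem_ofFn' _ _).1 hx
    exact gate_mem_unitary (hg α) _

theorem det_gateProduct {d : ℕ} {g : Fin d → Matrix (Fin N) (Fin N) ℂ}
    (hg : ∀ α, (g α).IsHermitian) (htr : ∀ α, (g α).trace = 0) (ω : Fin d → ℝ) :
    (gateProduct g ω).det = 1 := by
  change detMonoidHom _ = 1
  rw [gateProduct, map_list_prod]
  refine List.prod_eq_one fun x hx => ?_
  obtain ⟨y, hy, rfl⟩ := List.mem_map.1 hx
  obtain ⟨α, rfl⟩ := (List.mem_ofFn' _ _).1 hy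
  simp [det_gate (hg α), htr α]

theorem gateProduct_cons {d : ℕ} (g₀ : Matrix (Fin N) (Fin N) ℂ)
    (g : Fin d → Matrix (Fin N) (Fin N) ℂ) (ω : Fin (d + 1) → ℝ) :
    gateProduct (Fin.cons g₀ g : Fin (d + 1) → Matrix (Fin N) (Fin N) ℂ) ω =
      gate (ω 0) g₀ * gateProduct g (Fin.tail ω) := by
  simp [gateProduct, List.ofFn_succ, Fin.tail]

theorem hasStrictFDerivAt_gate_zero (g : Matrix (Fin N) (Fin N) ℂ) :
    HasStrictFDerivAt (fun t : ℝ => gate t g)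
      ((ContinuousLinearMap.id ℝ ℝ).smulRight (Complex.I • g)) 0 := by
  simp only [gate_eq_exp_real_smul]
  have h1 : HasStrictFDerivAt (fun t : ℝ => t • (Complex.I • g))
      ((ContinuousLinearMap.id ℝ ℝ).smulRight (Complex.I • g)) 0 :=
    ((ContinuousLinearMap.id ℝ ℝ).smulRight (Complex.I • g)).hasStrictFDerivAt
  have h2 : HasStrictFDerivAt (NormedSpace.exp : Matrix (Fin N) (Fin N) ℂ → _)
      (1 : Matrix (Fin N) (Fin N) ℂ →L[ℝ] Matrix (Fin N) (Fin N) ℂ)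
      ((0 : ℝ) • (Complex.I • g)) := by
    rw [zero_smul]
    exact hasStrictFDerivAt_exp_zero
  exact h2.comp 0 h1

theorem exists_hasStrictFDerivAt_gateProduct_zero {d : ℕ}
    (g : Fin d → Matrix (Fin N) (Fin N) ℂ) :
    ∃ F : (Fin d → ℝ) →L[ℝ] Matrix (Fin N) (Fin N) ℂ,
      HasStrictFDerivAt (gateProduct g) F 0 ∧ ∀ ω, F ω = ∑ α, ω α • (Complex.I • g α) := by
  have h1 : HasStrictFDerivAt (fun (ω : Fin d → ℝ) α => gate (ω α) (g α))
      (ContinuousLinearMap.pi fun α =>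
        (ContinuousLinearMap.proj α : (Fin d → ℝ) →L[ℝ] ℝ).smulRight (Complex.I • g α)) 0 :=
    hasStrictFDerivAt_pi.2 fun α =>
      (hasStrictFDerivAt_gate_zero (g α)).comp (0 : Fin d → ℝ)
        (ContinuousLinearMap.proj α : (Fin d → ℝ) →L[ℝ] ℝ).hasStrictFDerivAt
  have h2 := (hasStrictFDerivAt_list_prod_finRange' (𝕜 := ℝ)
    (x := fun α => gate ((0 : Fin d → ℝ) α) (g α))).comp (0 : Fin d → ℝ) h1
  simp only [← List.ofFn_eq_map] at h2
  refine ⟨_, h2, fun ω => ?_⟩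
  simp [gate_zero]

/-- The derivative at 0 is surjective: the gates give the skew-Hermitian part of a matrix, the
second factor the Hermitian part. -/
theorem map_nhds_zero_gateProduct_mul_one_add {d : ℕ} {g : Fin d → Matrix (Fin N) (Fin N) ℂ}
    (hspan : ∀ K : Matrix (Fin N) (Fin N) ℂ, K.IsHermitian →
      K ∈ Submodule.span ℝ (Set.range g)) :
    map (fun x : (Fin d → ℝ) × Matrix (Fin N) (Fin N) ℂ => gateProduct g x.1 * (1 + (x.2 + x.2ᴴ)))
      (𝓝 0) = 𝓝 1 := by
  obtain ⟨F, hF, hFω⟩ := exists_hasStrictFDerivAt_gateProduct_zero g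
  let T : Matrix (Fin N) (Fin N) ℂ →L[ℝ] Matrix (Fin N) (Fin N) ℂ :=
    ContinuousLinearMap.id ℝ _ + ((starL' ℝ : Matrix (Fin N) (Fin N) ℂ ≃L[ℝ] Matrix (Fin N) (Fin N) ℂ) :
      Matrix (Fin N) (Fin N) ℂ →L[ℝ] Matrix (Fin N) (Fin N) ℂ)
  have hT (B) : T B = B + Bᴴ := rfl
  have h1 : HasStrictFDerivAt (fun x : (Fin d → ℝ) × Matrix (Fin N) (Fin N) ℂ =>
      gateProduct g x.1) (F.comp (ContinuousLinearMap.fst ℝ _ _)) 0 :=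
    HasStrictFDerivAt.comp (0 : (Fin d → ℝ) × Matrix (Fin N) (Fin N) ℂ) hF hasStrictFDerivAt_fst
  have h2 : HasStrictFDerivAt (fun x : (Fin d → ℝ) × Matrix (Fin N) (Fin N) ℂ =>
      1 + (x.2 + x.2ᴴ)) (T.comp (ContinuousLinearMap.snd ℝ _ _)) 0 :=
    (T.comp (ContinuousLinearMap.snd ℝ (Fin d → ℝ) _)).hasStrictFDerivAt.const_add 1
  have h3 := h1.mul' h2
  have := h3.map_nhds_eq_of_surj ?_
  · simpa [gateProduct_zero, Pi.mul_def] using this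
  rw [LinearMap.range_eq_top]
  intro B
  -- Multiplied by `i`, this is the skew-Hermitian part of `B`.
  have hK : ((2 : ℝ)⁻¹ • (-Complex.I • (B - Bᴴ))).IsHermitian := by
    refine IsHermitian.real_smul ?_ _
    simp [Matrix.IsHermitian, conjTranspose_smul, smul_sub, add_comm]
  obtain ⟨ω, hω⟩ := (Submodule.mem_span_range_iff_exists_fun ℝ).1 (hspan _ hK)
  -- The factor is 1/4 because `T` doubles Hermitian matrices.
  refine ⟨(ω, (4 : ℝ)⁻¹ • (B + Bᴴ)), ?_⟩
  have hF' : F ω = (2 : ℝ)⁻¹ • (B - Bᴴ) := by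
    rw [hFω]
    simp only [smul_comm _ Complex.I]
    rw [← Finset.smul_sum, hω, smul_comm, smul_smul]
    simp
  have hT' : T ((4 : ℝ)⁻¹ • (B + Bᴴ)) = (2 : ℝ)⁻¹ • (B + Bᴴ) := by
    rw [hT, conjTranspose_smul, conjTranspose_add, conjTranspose_conjTranspose, star_trivial,
      add_comm Bᴴ B, ← add_smul]
    norm_num
  have : F ω + T ((4 : ℝ)⁻¹ • (B + Bᴴ)) = B := by
    rw [hF', hT', ← smul_add, sub_add_add_cancel, ← two_smul ℝ B, smul_smul]
    norm_num
  simpa [gateProduct_zero, add_comm] using this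

/-- If the `g α` span the Hermitian matrices, the unitaries near `1` are gate products with small
parameters. -/
theorem eventually_exists_gateProduct_eq {d : ℕ} {g : Fin d → Matrix (Fin N) (Fin N) ℂ}
    (hg : ∀ α, (g α).IsHermitian)
    (hspan : ∀ K : Matrix (Fin N) (Fin N) ℂ, K.IsHermitian →
      K ∈ Submodule.span ℝ (Set.range g))
    {W : Set (Fin d → ℝ)} (hW : W ∈ 𝓝 0) :
    ∀ᶠ U in 𝓝 (1 : Matrix (Fin N) (Fin N) ℂ), U ∈ unitary (Matrix (Fin N) (Fin N) ℂ) →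
      ∃ ω ∈ W, gateProduct g ω = U := by
  -- The bound 2 is what excludes the nonzero solutions of `H² = -2H`, which have norm exactly 2.
  have hB : ∀ᶠ x : (Fin d → ℝ) × Matrix (Fin N) (Fin N) ℂ in 𝓝 0,
      x.1 ∈ W ∧ ‖x.2 + x.2ᴴ‖ < 2 := by
    have hfst : Tendsto Prod.fst (𝓝 (0 : (Fin d → ℝ) × Matrix (Fin N) (Fin N) ℂ)) (𝓝 0) :=
      continuous_fst.tendsto _
    refine (hfst.eventually_mem hW).and ?_
    have hc : Continuous fun x : (Fin d → ℝ) × Matrix (Fin N) (Fin N) ℂ => ‖x.2 + x.2ᴴ‖ :=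
      (continuous_snd.add (continuous_star.comp continuous_snd)).norm
    exact hc.tendsto' 0 0 (by simp) |>.eventually (gt_mem_nhds two_pos)
  have := image_mem_map (m := fun x : (Fin d → ℝ) × Matrix (Fin N) (Fin N) ℂ =>
    gateProduct g x.1 * (1 + (x.2 + x.2ᴴ))) hB
  rw [map_nhds_zero_gateProduct_mul_one_add hspan] at this
  filter_upwards [this]
  rintro _ ⟨⟨ω, B⟩, ⟨hω, hlt⟩, rfl⟩ hU
  refine ⟨ω, hω, ?_⟩
  simp only at hlt hU ⊢
  set H := B + Bᴴ with hH
  have hHs : star H = H := by simp [hH, star_eq_conjTranspose, add_comm]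
  have hu : 1 + H ∈ unitary (Matrix (Fin N) (Fin N) ℂ) := by
    have := mul_mem (Unitary.star_mem (gateProduct_mem_unitary hg ω)) hU
    rwa [← mul_assoc, Unitary.star_mul_self_of_mem (gateProduct_mem_unitary hg ω), one_mul] at this
  have hsq : H * H = -(2 • H) := by
    have := Unitary.star_mul_self_of_mem hu
    rw [star_add, star_one, hHs] at this
    have h2 : H * H + 2 • H + 1 = (1 + H) * (1 + H) := by noncomm_ring
    exact eq_neg_of_add_eq_zero_left (add_eq_right.1 (h2.trans this))
  have hnorm : ‖H‖ * ‖H‖ = 2 * ‖H‖ := by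
    rw [← CStarRing.norm_star_mul_self, hHs, hsq, norm_neg, ← Nat.cast_smul_eq_nsmul ℝ, norm_smul]
    norm_num
  have : H = 0 := by
    rw [← norm_eq_zero]
    by_contra h
    exact hlt.ne (mul_right_cancel₀ h hnorm)
  rw [this, add_zero, mul_one]

/-- If the traceless `g α` together with the identity span the Hermitian matrices, the special
unitaries near `1` are gate products. -/
theorem eventually_exists_gateProduct_eq_of_specialUnitary [NeZero N] {d : ℕ}
    {g : Fin d → Matrix (Fin N) (Fin N) ℂ}
    (hg : ∀ α, (g α).IsHermitian) (htr : ∀ α, (g α).trace = 0)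
    (hspan : ∀ K : Matrix (Fin N) (Fin N) ℂ, K.IsHermitian →
      K ∈ Submodule.span ℝ (insert 1 (Set.range g))) :
    ∀ᶠ U in 𝓝 (1 : Matrix (Fin N) (Fin N) ℂ), U ∈ specialUnitaryGroup (Fin N) ℂ →
      ∃ ω, gateProduct g ω = U := by
  have hN : (0 : ℝ) < N := by exact_mod_cast NeZero.pos N
  let g' : Fin (d + 1) → Matrix (Fin N) (Fin N) ℂ := Fin.cons 1 g
  have hg' : ∀ α, (g' α).IsHermitian := Fin.cases isHermitian_one hg
  -- The identity gate has determinant `exp(i N ω₀)`; for `|N ω₀| < 1` it equals 1 only if `ω₀ = 0`.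
  have hW : {ω : Fin (d + 1) → ℝ | |ω 0| < 1 / N} ∈ 𝓝 0 := by
    have hc : Continuous fun ω : Fin (d + 1) → ℝ => |ω 0| := by fun_prop
    exact hc.tendsto' 0 0 (by simp) |>.eventually (gt_mem_nhds (by positivity))
  filter_upwards [eventually_exists_gateProduct_eq hg' (by rwa [Fin.range_cons]) hW] with U h hU
  rw [mem_specialUnitaryGroup_iff] at hU
  obtain ⟨ω, hω, rfl⟩ := h hU.1
  refine ⟨Fin.tail ω, ?_⟩
  have hdet := hU.2
  rw [gateProduct_cons, det_mul, det_gateProduct hg htr, mul_one, det_gate isHermitian_one,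
    trace_one, Fintype.card_fin, Complex.exp_eq_one_iff] at hdet
  obtain ⟨k, hk⟩ := hdet
  have hk' : ω 0 * N = k * (2 * Real.pi) := by
    have : (Complex.I : ℂ) * (ω 0 * N) = Complex.I * (k * (2 * Real.pi)) := by
      rw [hk]; ring
    exact_mod_cast mul_left_cancel₀ Complex.I_ne_zero this
  have hlt : |ω 0 * N| < 1 := by
    rw [abs_mul, abs_of_pos hN]
    exact (lt_div_iff₀ hN).1 hω
  have hk0 : k = 0 := by
    by_contra hne
    have h1 : (1 : ℝ) ≤ |(k : ℝ)| := by exact_mod_cast Int.one_le_abs hne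
    rw [hk', abs_mul, abs_of_pos Real.two_pi_pos] at hlt
    nlinarith [Real.pi_gt_three]
  have hω0 : ω 0 = 0 := by
    rw [hk0] at hk'
    simpa [hN.ne'] using hk'
  rw [gateProduct_cons, hω0, gate_zero, one_mul]

end GateProducts

end GateDecomposition

namespace GateDecomposition

open Matrix Topology Filter
open scoped Matrix.Norms.L2Operator Pointwise

/-! ### From a neighbourhood of 1 to all of `SU(N)`. -/

section Global

variable {N : ℕ}

/-- The scalar matrices of `SU(N)` are exponentials of multiples of a fixed traceless diagonal
matrix. -/
theorem exp_I_smul_diagonal_eq_smul_one [NeZero N] {φ : ℝ}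
    (h : Complex.exp (Complex.I * φ) ^ N = 1) :
    NormedSpace.exp (Complex.I • (φ • diagonal fun a : Fin N => if a = 0 then 1 - (N : ℂ) else 1)) =
      Complex.exp (Complex.I * φ) • (1 : Matrix (Fin N) (Fin N) ℂ) := by
  rw [← diagonal_smul, ← diagonal_smul, Matrix.exp_diagonal, smul_one_eq_diagonal]
  congr 1
  ext a
  rw [Pi.coe_exp, ← Complex.exp_eq_exp_ℂ]
  by_cases ha : a = 0
  -- The exceptional entry is `exp(iφ) / exp(iφ)^N`, and the denominator is 1.
  · have : Complex.I • (φ : ℂ) • (1 - (N : ℂ)) = Complex.I * φ - N * (Complex.I * φ) := by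
      simp only [smul_eq_mul]; ring
    simp only [Pi.smul_apply, ha, if_true]
    erw [this]
    rw [Complex.exp_sub, Complex.exp_nat_mul, h, div_one]
  · simp [ha]

/-- Every special unitary matrix is a product of two exponentials of traceless Hermitian matrices
whose norms are bounded in terms of `N` only. -/
theorem exists_exp_mul_exp_eq (N : ℕ) [NeZero N] : ∃ C : ℝ,
    ∀ U ∈ specialUnitaryGroup (Fin N) ℂ, ∃ K₁ K₂ : Matrix (Fin N) (Fin N) ℂ,
      (K₁.IsHermitian ∧ K₁.trace = 0 ∧ ‖K₁‖ ≤ C) ∧ (K₂.IsHermitian ∧ K₂.trace = 0 ∧ ‖K₂‖ ≤ C) ∧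
      NormedSpace.exp (Complex.I • K₁) * NormedSpace.exp (Complex.I • K₂) = U := by
  set D : Matrix (Fin N) (Fin N) ℂ := diagonal fun a => if a = 0 then 1 - (N : ℂ) else 1 with hD
  have hDH : D.IsHermitian := by
    rw [hD, Matrix.IsHermitian, diagonal_conjTranspose]
    congr 1
    ext a
    by_cases ha : a = 0 <;> simp [ha]
  have hDtr : D.trace = 0 := by
    rw [hD, trace_diagonal, ← Finset.add_sum_erase _ _ (Finset.mem_univ (0 : Fin N)),
      Finset.sum_congr rfl fun a ha => if_neg (Finset.ne_of_mem_erase ha)]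
    simp [Finset.card_erase_of_mem, Nat.cast_sub (NeZero.one_le : 1 ≤ N)]
  have hN : (N : ℂ) ≠ 0 := NeZero.ne _
  obtain ⟨B, hB⟩ : ∃ B, ∀ H : Matrix (Fin N) (Fin N) ℂ, ‖H‖ ≤ Real.pi →
      ‖H - (H.trace / N) • 1‖ ≤ B := by
    have hc : Continuous fun H : Matrix (Fin N) (Fin N) ℂ => H - (H.trace / N) • 1 := by
      fun_prop
    obtain ⟨B, hB⟩ :=
      (isCompact_closedBall (0 : Matrix (Fin N) (Fin N) ℂ) Real.pi).exists_bound_of_continuousOn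
      hc.continuousOn
    exact ⟨B, fun H hH => hB H (by simpa using hH)⟩
  refine ⟨max B (Real.pi * ‖D‖), fun U hU => ?_⟩
  rw [mem_specialUnitaryGroup_iff] at hU
  obtain ⟨H, hH, hHn, rfl⟩ := exists_exp_I_smul_eq hU.1
  obtain ⟨t, ht⟩ : ∃ t : ℝ, H.trace / N = t := by
    have : star H.trace = H.trace := by rw [← trace_conjTranspose, hH.eq]
    obtain ⟨r, hr⟩ := Complex.conj_eq_iff_real.1 this
    exact ⟨r / N, by rw [hr]; push_cast; rfl⟩
  have hBH := hB H hHn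
  rw [ht] at hBH
  -- The logarithm `H` need not be traceless: its trace part contributes a scalar matrix in `SU(N)`,
  -- which becomes the second exponential.
  set K := H - (t : ℂ) • (1 : Matrix (Fin N) (Fin N) ℂ) with hK
  have hKH : K.IsHermitian := hH.sub (IsHermitian.real_smul isHermitian_one t)
  have hKtr : K.trace = 0 := by
    rw [hK, trace_sub, trace_smul, trace_one, Fintype.card_fin, ← ht, smul_eq_mul,
      div_mul_cancel₀ _ hN, sub_self]
  have hsplit : NormedSpace.exp (Complex.I • H) =
      NormedSpace.exp (Complex.I • K) *
        (Complex.exp (Complex.I * t) • (1 : Matrix (Fin N) (Fin N) ℂ)) := by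
    have h1 : Complex.I • H = Complex.I • K + (Complex.I * t) • 1 := by
      rw [hK, smul_sub, smul_smul, sub_add_cancel]
    have h2 : Commute (Complex.I • K) ((Complex.I * t) • (1 : Matrix (Fin N) (Fin N) ℂ)) :=
      (Commute.one_right _).smul_right _
    rw [h1, Matrix.exp_add_of_commute _ _ h2, smul_one_eq_diagonal, smul_one_eq_diagonal,
      Matrix.exp_diagonal]
    congr 2
    ext a
    rw [Pi.coe_exp, Complex.exp_eq_exp_ℂ]
  have hdet := hU.2
  rw [hsplit, det_mul, det_exp_I_smul hKH, hKtr, mul_zero, Complex.exp_zero, one_mul, det_smul,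
    det_one, mul_one, Fintype.card_fin] at hdet
  set φ : ℝ := (Complex.exp (Complex.I * t)).arg with hφ
  have hφe : Complex.exp (Complex.I * φ) = Complex.exp (Complex.I * t) := by
    have := Complex.norm_mul_exp_arg_mul_I (Complex.exp (Complex.I * t))
    rwa [mul_comm Complex.I (t : ℂ), Complex.norm_exp_ofReal_mul_I, Complex.ofReal_one, one_mul,
      mul_comm _ Complex.I, mul_comm (t : ℂ)] at this
  refine ⟨K, φ • D, ⟨hKH, hKtr, hBH.trans (le_max_left _ _)⟩,
    ⟨IsHermitian.real_smul hDH φ, by rw [trace_smul, hDtr, smul_zero], ?_⟩, ?_⟩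
  · rw [norm_smul]
    exact (mul_le_mul_of_nonneg_right (Complex.abs_arg_le_pi _) (norm_nonneg _)).trans
      (le_max_right _ _)
  · rw [hD, exp_I_smul_diagonal_eq_smul_one (hφe ▸ hdet), hφe, hsplit]

theorem exp_I_smul_mem_specialUnitaryGroup {K : Matrix (Fin N) (Fin N) ℂ} (hK : K.IsHermitian)
    (htr : K.trace = 0) :
    NormedSpace.exp (Complex.I • K) ∈ specialUnitaryGroup (Fin N) ℂ :=
  mem_specialUnitaryGroup_iff.2 ⟨exp_I_smul_mem_unitary hK, by simp [det_exp_I_smul hK, htr]⟩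

/-- A neighbourhood of `1` generates `SU(N)` in a bounded number of steps. -/
theorem exists_specialUnitaryGroup_subset_pow [NeZero N] {V : Set (Matrix (Fin N) (Fin N) ℂ)}
    (hV : ∀ᶠ U in 𝓝 (1 : Matrix (Fin N) (Fin N) ℂ), U ∈ specialUnitaryGroup (Fin N) ℂ → U ∈ V) :
    ∃ k : ℕ, ∀ U ∈ specialUnitaryGroup (Fin N) ℂ, U ∈ V ^ k := by
  obtain ⟨C, hC⟩ := exists_exp_mul_exp_eq N
  have hexp : Tendsto (fun K : Matrix (Fin N) (Fin N) ℂ => NormedSpace.exp (Complex.I • K))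
      (𝓝 0) (𝓝 1) := by
    have h1 : ContinuousAt (NormedSpace.exp : Matrix (Fin N) (Fin N) ℂ → _) 0 :=
      (hasStrictFDerivAt_exp_zero (𝕂 := ℝ)).continuousAt
    have h2 : Tendsto (fun K : Matrix (Fin N) (Fin N) ℂ => Complex.I • K) (𝓝 0) (𝓝 0) :=
      (continuous_const_smul Complex.I).tendsto' _ _ (smul_zero _)
    simpa [Function.comp_def] using h1.tendsto.comp h2
  obtain ⟨δ, hδ, hball⟩ := Metric.eventually_nhds_iff.1 (hexp.eventually hV)
  -- This makes `‖K / k‖ < δ` whenever `‖K‖ ≤ C`; the maximum with 0 ensures `k > 0`.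
  obtain ⟨k, hk⟩ := exists_nat_gt (max (C / δ) 0)
  have hk0 : (0 : ℝ) < k := (le_max_right _ _).trans_lt hk
  have hCk : C / k < δ := by
    have := (le_max_left _ _).trans_lt hk
    rw [div_lt_iff₀ hδ] at this
    rwa [div_lt_iff₀ hk0, mul_comm]
  have hpow (K : Matrix (Fin N) (Fin N) ℂ) (hK : K.IsHermitian ∧ K.trace = 0 ∧ ‖K‖ ≤ C) :
      NormedSpace.exp (Complex.I • K) ∈ V ^ k := by
    have h1 : NormedSpace.exp (Complex.I • ((k : ℝ)⁻¹ • K)) ∈ V := by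
      refine hball ?_ (exp_I_smul_mem_specialUnitaryGroup (IsHermitian.real_smul hK.1 _)
        (by rw [trace_smul, hK.2.1, smul_zero]))
      rw [dist_zero_right, norm_smul, norm_inv, Real.norm_natCast, inv_mul_eq_div]
      exact (div_le_div_of_nonneg_right hK.2.2 hk0.le).trans_lt hCk
    have h2 : Complex.I • K = k • (Complex.I • ((k : ℝ)⁻¹ • K)) := by
      rw [← Nat.cast_smul_eq_nsmul ℝ, smul_comm (k : ℝ), smul_inv_smul₀ hk0.ne']
    rw [h2, Matrix.exp_nsmul]
    exact Set.pow_mem_pow h1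
  refine ⟨k + k, fun U hU => ?_⟩
  obtain ⟨K₁, K₂, h₁, h₂, rfl⟩ := hC U hU
  rw [pow_add]
  exact Set.mul_mem_mul (hpow K₁ h₁) (hpow K₂ h₂)

/-- As pointwise products of sets, ranges of gate products turn concatenation of generator lists
into multiplication, which handles the power `V ^ k`. -/
theorem range_gateProduct {d : ℕ} (g : Fin d → Matrix (Fin N) (Fin N) ℂ) :
    Set.range (gateProduct g) = (List.ofFn fun α => Set.range fun t => gate t (g α)).prod := by
  ext U
  rw [Set.mem_prod_list_ofFn]
  constructor
  · rintro ⟨ω, rfl⟩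
    exact ⟨fun α => ⟨gate (ω α) (g α), ω α, rfl⟩, rfl⟩
  · rintro ⟨f, rfl⟩
    choose ω hω using fun α => (f α).2
    exact ⟨ω, congrArg (fun l => (List.ofFn l).prod) (funext hω)⟩

end Global

end GateDecomposition

/-! ### The decomposition theorem. -/

open GateDecomposition in
open scoped Pointwise in
theorem mainTheorem4 (N m : ℕ) (p : Fin m → ℕ) (hp : ∀ k, (p k).Prime) (hN : N = ∏ k, p k)
    (e : (∀ k, Fin (p k)) ≃ Fin N)
    (D : ∀ k, Set (Fin (p k) → ℝ)) (hD : ∀ k, GateDecomposition.IsDiagonalSystem (D k)) :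
    ∃ (n : ℕ) (g : Fin n → Matrix (Fin N) (Fin N) ℂ),
      (∀ α, GateDecomposition.IsLocalGenerator e D (g α) ∨
        GateDecomposition.IsNonlocalGenerator e D (g α)) ∧
      ∀ U ∈ Matrix.specialUnitaryGroup (Fin N) ℂ, ∃ ω : Fin n → ℝ,
        U = (List.ofFn fun α => GateDecomposition.gate (ω α) (g α)).prod := by
  have : NeZero N := ⟨hN ▸ Finset.prod_ne_zero_iff.2 fun k _ => (hp k).ne_zero⟩
  -- Finitely many gate generators already have the full real span.
  obtain ⟨s, hs, hspan⟩ := (Submodule.fg_span_iff_fg_span_finset_subset (gateGenerators e D)).1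
    (IsNoetherian.noetherian (R := ℝ) _)
  set l := s.toList with hl
  have hmem (α : Fin l.length) : l.get α ∈ gateGenerators e D :=
    hs (Finset.mem_toList.1 (l.get_mem α))
  have hrange : Set.range l.get = s := by
    ext x
    rw [Set.range_list_get]
    simp [hl]
  have hlocal := eventually_exists_gateProduct_eq_of_specialUnitary (g := l.get)
    (fun α => isHermitian_of_mem_gateGenerators (hmem α))
    (fun α => trace_of_mem_gateGenerators hD (hmem α)) fun K hK => by
      rw [hrange, Submodule.span_insert, ← hspan, ← Submodule.span_insert]
      exact mem_span_insert_one_gateGenerators (fun k => (hp k).ne_zero) hD hK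
  obtain ⟨k, hk⟩ := exists_specialUnitaryGroup_subset_pow (V := Set.range (gateProduct l.get)) hlocal
  -- The sequence is `l` repeated `k` times, fixed before `U` is introduced.
  refine ⟨_, (List.replicate k l).flatten.get, fun α => ?_, fun U hU => ?_⟩
  · obtain ⟨l', hl', h⟩ := List.mem_flatten.1 ((List.replicate k l).flatten.get_mem α)
    rw [List.eq_of_mem_replicate hl'] at h
    exact hs (Finset.mem_toList.1 h)
  · have hpow (L : List (Matrix (Fin N) (Fin N) ℂ)) : Set.range (gateProduct L.get) =
        (L.map fun g => Set.range fun t => gate t g).prod := by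
      rw [range_gateProduct]
      congr 1
      exact List.ofFn_getElem_eq_map L fun g => Set.range fun t => gate t g
    have hU' := hk U hU
    rw [hpow, ← List.prod_replicate, ← List.map_replicate, ← List.map_replicate, ← List.prod_flatten,
      ← List.map_flatten, ← hpow] at hU'
    obtain ⟨ω, hω⟩ := hU'
    exact ⟨ω, hω.symm⟩
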